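/- Composition of maps and morphisms is written from left to right. **Left ideals.** An inverse semigroup is a semigroup $S$ in which every $a$ has a unique $b$ with $aba=a$, $bab=b$. The category $\mathbb{L}(S)$ has as objects the sets $Se=\{se: s\in S\}$ with $e\in S$ idempotent; its morphisms $Se\to Sf$ ($e,f$ idempotent) are the maps $\rho(e,u,f)\colon x\mapsto xu$ with $u\in eSf$, under composition of maps. Its inclusions are the morphisms that are inclusion maps $Se\subseteq Sf$. **Categories with subobjects.** Let $\mathcal{C}$ be a small category and $\mathcal{P}$ a class of morphisms of $\mathcal{C}$, called inclusions. $(\mathcal{C},\mathcal{P})$ is a category with subobjects if: $\mathcal{P}$ is a subcategory with all objects of $\mathcal{C}$; there is at most one inclusion between any two objects, and the only isomorphisms of the category $\mathcal{P}$ are identities; every inclusion is a monomorphism in $\mathcal{C}$; and if $\varphi=\alpha\psi$ with $\varphi,\psi\in\mathcal{P}$ and $\alpha\in\mathcal{C}$, then $\alpha\in\mathcal{P}$. Write $c\le d$ if there is an inclusion $\iota(c,d)\colon c\to d$. It is an so-category if any two objects $c,d$ have a meet $c\wedge d$ with respect to $\le$. A retraction is a morphism $q\colon c\to c'$ such that $c'\le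 c$ and $\iota(c',c)\,q=1_{c'}$; one then says that $q$ splits $\iota(c',c)$. A normal factorisation of $\varphi$ is an expression $\varphi=\theta\sigma\iota$ with $\theta$ a retraction, $\sigma$ an isomorphism, $\iota$ an inclusion; then $\varphi^\circ=\theta\sigma$ is the epimorphic component and the codomain of $\theta$ is the coimage of $\varphi$. The core is the subcategory generated by inclusions and retractions. **Cones.** A cone $\gamma$ with apex $d$ is a family of morphisms $\gamma(c)\colon c\to d$, one for each object $c$, with $\iota(a,b)\gamma(b)=\gamma(a)$ whenever $a\le b$. It is inversive if there is exactly one object $m$ for which $\gamma(m)$ is an isomorphism, and for every object $c$ the coimage of $\gamma(c)$ is $c\wedge m$. It is idempotent if $\gamma\cdot\gamma=\gamma$, where $\gamma\cdot\delta$ is the cone $c\mapsto\gamma(c)\,(\delta(c_\gamma))^\circ$ and $c_\gamma$ is the apex of $\gamma$. **Inversive categories.** $(\mathcal{C},\mathcal{P})$ is inversive if: 1. it is an so-category; 2. every inclusion is split by a unique retraction; 3. every morphism has a unique normal factorisation; 4. every morphism $f$ of the core has an inversive factorisation: whenever $f=\iota(c_1,c_2)q(c_2,c_3)\cdots\iota(c_{2n-1},c_{2n})q(c_{2n},c_{2n+1})$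 with inclusions $\iota$ and retractions $q$, then $f$ is the composite of a retraction $c_1\to d$ and the inclusion $\iota(d,c_{2n+1})$, where $d=c_1\wedge c_3\wedge\cdots\wedge c_{2n+1}$; 5. every object is the apex of exactly one idempotent inversive cone. **Corollary.** Let $\mathcal{C}$ be a small category and $\mathcal{P}$ a class of morphisms of $\mathcal{C}$. Then $(\mathcal{C},\mathcal{P})$ is inversive if and only if there are an inverse semigroup $S$ and an isomorphism of categories $\mathcal{C}\cong\mathbb{L}(S)$ which, together with its inverse, preserves inclusions. (The empty semigroup and the empty category are allowed.) -/

import Mathlib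

open CategoryTheory

universe v u w

/-! ### Inverse semigroups and the category of principal left ideals -/

/-- A semigroup is inverse if every element has a unique inverse. -/
def IsInverseSemigroup (S : Type w) [Semigroup S] : Prop :=
  ∀ a : S, ∃! b : S, a * b * a = a ∧ b * a * b = b

/-- The left ideal `Se`. -/
def leftIdeal {S : Type w} [Semigroup S] (e : S) : Set S := {x | ∃ s : S, x = s * e}

/-- The objects of `𝕃(S)`: the subsets of `S` of the form `Se` with `e` idempotent. -/
structure PrincipalLeftIdeal (S : Type w) [Semigroup S] where
  carrier : Set S
  exists_idempotent : ∃ e : S, e * e = e ∧ carrier = leftIdeal e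

namespace PrincipalLeftIdeal

variable {S : Type w} [Semigroup S]

/-- `φ : I → J` is the partial right translation `ρ(e, u, f)`: here `I = Se` and `J = Sf` with
`e`, `f` idempotent, `u ∈ eSf`, and `φ` sends `x` to `xu`. -/
structure IsTranslation {I J : PrincipalLeftIdeal S} (φ : I.carrier → J.carrier)
    (e u f : S) : Prop where
  idem_dom : e * e = e
  idem_cod : f * f = f
  dom_eq : I.carrier = leftIdeal e
  cod_eq : J.carrier = leftIdeal f
  mem : ∃ s : S, u = e * s * f
  apply_eq : ∀ x : I.carrier, (φ x : S) = (x : S) * u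

/-- The morphisms of `𝕃(S)`: the maps of the form `ρ(e, u, f)`. -/
@[ext]
structure Hom (I J : PrincipalLeftIdeal S) where
  toFun : I.carrier → J.carrier
  exists_translation : ∃ e u f : S, IsTranslation toFun e u f

/-- The category `𝕃(S)` of principal left ideals; composition is composition of maps, written
from left to right. -/
instance : Category (PrincipalLeftIdeal S) where
  Hom := Hom
  id I := ⟨id, by
    obtain ⟨e, he, hI⟩ := I.exists_idempotent
    refine ⟨e, e, e, he, he, hI, hI, ⟨e, by rw [he, he]⟩, fun x => ?_⟩
    obtain ⟨x, hx⟩ := x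
    rw [hI] at hx
    obtain ⟨s, rfl⟩ := hx
    simp [mul_assoc, he]⟩
  comp φ ψ := ⟨ψ.toFun ∘ φ.toFun, by
    obtain ⟨e, u, f, h⟩ := φ.exists_translation
    obtain ⟨g, v, k, h'⟩ := ψ.exists_translation
    obtain ⟨s, hs⟩ := h.mem
    obtain ⟨t, ht⟩ := h'.mem
    refine ⟨e, u * v, k, h.idem_dom, h'.idem_cod, h.dom_eq, h'.cod_eq,
      ⟨s * f * (g * t), by rw [hs, ht]; simp only [mul_assoc]⟩, fun x => ?_⟩
    simp only [Function.comp_apply, h'.apply_eq, h.apply_eq, mul_assoc]⟩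

/-- The inclusions of `𝕃(S)`: the morphisms `Se → Sf` that are inclusion maps `x ↦ x` of a subset
(that is, the morphisms `ρ(e, e, f)` with `Se ⊆ Sf`). -/
def inclusions (S : Type w) [Semigroup S] : MorphismProperty (PrincipalLeftIdeal S) :=
  fun I _ φ => ∀ x : I.carrier, ((Hom.toFun φ x : _) : S) = (x : S)

end PrincipalLeftIdeal

/-! ### Categories with subobjects

The subcategory of inclusions, which has the same objects as the category `C`, is given by the
class `P` of its morphisms. Composition `f ≫ g` is read from left to right. -/

section Subobjects

variable {C : Type u} [Category.{v} C] (P : MorphismProperty C)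

/-- There is an inclusion from `a` to `b`. -/
def SubobjectLE (a b : C) : Prop := ∃ i : a ⟶ b, P i

/-- `(C, P)` is a category with subobjects. -/
structure IsCategoryWithSubobjects : Prop where
  /-- `P` is a subcategory of `C` with the same objects. -/
  isMultiplicative : P.IsMultiplicative
  /-- `P` is a preorder. -/
  thin : ∀ {a b : C} (i j : a ⟶ b), P i → P j → i = j
  /-- The preorder is strict: the isomorphisms of the subcategory `P` are identities. -/
  strict : ∀ {a b : C} (i : a ⟶ b) (j : b ⟶ a), P i → P j → i ≫ j = 𝟙 a → j ≫ i = 𝟙 b →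
    ∃ h : a = b, i = eqToHom h
  /-- Every inclusion is a monomorphism of `C`. -/
  mono : ∀ {a b : C} (i : a ⟶ b), P i → Mono i
  /-- If `φ = α ≫ ψ` with `φ` and `ψ` inclusions then `α` is an inclusion. -/
  of_comp : ∀ {a b c : C} (α : a ⟶ b) (ψ : b ⟶ c), P ψ → P (α ≫ ψ) → P α

/-- `d` is the meet (greatest lower bound) of the set `s` of objects, with respect to the
existence of inclusions. -/
def IsMeet (d : C) (s : Set C) : Prop :=
  (∀ x ∈ s, SubobjectLE P d x) ∧ ∀ d' : C, (∀ x ∈ s, SubobjectLE P d' x) → SubobjectLE P d' d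

/-- `(C, P)` is a semilattice ordered category (so-category). -/
structure IsSOCategory : Prop extends IsCategoryWithSubobjects P where
  exists_meet : ∀ a b : C, ∃ d : C, IsMeet P d {a, b}

/-- `q : c ⟶ c'` splits the inclusion `i : c' ⟶ c`. -/
def Splits {c' c : C} (i : c' ⟶ c) (q : c ⟶ c') : Prop := i ≫ q = 𝟙 c'

/-- A retraction is a morphism that splits some inclusion. -/
def IsRetraction {c c' : C} (q : c ⟶ c') : Prop := ∃ i : c' ⟶ c, P i ∧ Splits i q

/-- A normal factorisation `φ = θσι`: a retraction, an isomorphism and an inclusion. -/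
structure NormalFactorisation {a b : C} (φ : a ⟶ b) where
  /-- the coimage -/
  coim : C
  /-- the image -/
  im : C
  θ : a ⟶ coim
  σ : coim ≅ im
  ι : im ⟶ b
  retraction : IsRetraction P θ
  inclusion : P ι
  fac : θ ≫ σ.hom ≫ ι = φ

/-- The epimorphic component `θσ`. -/
def NormalFactorisation.epiComponent {P : MorphismProperty C} {a b : C} {φ : a ⟶ b}
    (F : NormalFactorisation P φ) : a ⟶ F.im := F.θ ≫ F.σ.hom

/-! ### The core and inversive factorisations -/

/-- The core: the subcategory generated by the retractions and the inclusions. -/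
def core : MorphismProperty C :=
  (P ⊔ fun _ _ q => IsRetraction P q : MorphismProperty C).multiplicativeClosure

/-- `AlternatingProduct P a b f s`: the morphism `f` from `a = c₁` to `b = c₂ₙ₊₁` is written as
`ι(c₁,c₂) q(c₂,c₃) ⋯ ι(c₂ₙ₋₁,c₂ₙ) q(c₂ₙ,c₂ₙ₊₁)` with inclusions `ι` and retractions `q`, and
`s = {c₁, c₃, …, c₂ₙ₊₁}`. -/
inductive AlternatingProduct (a : C) : ∀ b : C, (a ⟶ b) → Set C → Prop
  | nil : AlternatingProduct a a (𝟙 a) {a}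
  | snoc {b c d : C} (f : a ⟶ b) (s : Set C) (i : b ⟶ c) (q : c ⟶ d)
      (hf : AlternatingProduct a b f s) (hi : P i) (hq : IsRetraction P q) :
      AlternatingProduct a d (f ≫ i ≫ q) (insert d s)

/-- `f` has an inversive factorisation: however `f` is written as an alternating product, `f` is
the composite of a retraction onto the meet `d` of the objects `c₁, c₃, …, c₂ₙ₊₁` and the
inclusion of `d`. -/
def HasInversiveFactorisation {a b : C} (f : a ⟶ b) : Prop :=
  ∀ s : Set C, AlternatingProduct P a b f s →
    ∃ (d : C) (q : a ⟶ d) (i : d ⟶ b), IsMeet P d s ∧ IsRetraction P q ∧ P i ∧ f = q ≫ i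

/-! ### Cones -/

/-- A cone with apex `apex`: it is compatible with the inclusions. -/
structure SubobjectCone where
  apex : C
  app : ∀ a : C, a ⟶ apex
  comp_app : ∀ {a b : C} (i : a ⟶ b), P i → i ≫ app b = app a

variable {P}

namespace SubobjectCone

/-- The `M`-set of a cone. -/
def mSet (γ : SubobjectCone P) : Set C := {c | IsIso (γ.app c)}

/-- The cone `γ ∗ φ`, with components `γ(c)φ`. -/
def star (γ : SubobjectCone P) {d : C} (φ : γ.apex ⟶ d) : SubobjectCone P where
  apex := d
  app a := γ.app a ≫ φ
  comp_app i hi := by rw [← Category.assoc, γ.comp_app i hi]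

/-- `ε` is the product `γ · δ = γ ∗ (δ(c_γ))°` of cones, where `c_γ` is the apex of `γ` and `φ°`
is the epimorphic component of `φ`. -/
def IsProduct (γ δ ε : SubobjectCone P) : Prop :=
  ∃ F : NormalFactorisation P (δ.app γ.apex), ε = γ.star F.epiComponent

/-- A cone `γ` is idempotent if `γ · γ = γ`. -/
def IsIdempotent (γ : SubobjectCone P) : Prop := IsProduct γ γ γ

/-- A cone `γ` is inversive if its `M`-set is a singleton `{m}` and the coimage of `γ(c)` is
`c ∧ m` for each object `c`. -/
def IsInversive (γ : SubobjectCone P) : Prop :=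
  ∃ m : C, γ.mSet = {m} ∧
    ∀ c : C, ∃ F : NormalFactorisation P (γ.app c), IsMeet P F.coim {c, m}

end SubobjectCone

/-! ### Inversive categories -/

variable (P)

/-- `(C, P)` is an inversive category. -/
structure IsInversiveCategory : Prop where
  /-- `(C, P)` is an so-category. -/
  isSOCategory : IsSOCategory P
  /-- Every inclusion splits uniquely. -/
  splits_uniquely : ∀ {a b : C} (i : a ⟶ b), P i → ∃! q : b ⟶ a, Splits i q
  /-- Every morphism has a unique normal factorisation. -/
  unique_normalFactorisation : ∀ {a b : C} (φ : a ⟶ b),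
    Nonempty (Unique (NormalFactorisation P φ))
  /-- Every morphism of the core has an inversive factorisation. -/
  inversive_factorisation : ∀ {a b : C} (f : a ⟶ b), core P f → HasInversiveFactorisation P f
  /-- Each object is the apex of a unique idempotent inversive cone. -/
  unique_cone : ∀ c : C,
    ∃! μ : SubobjectCone P, μ.apex = c ∧ μ.IsInversive ∧ μ.IsIdempotent

end Subobjects

/-- An isomorphism of categories equipped with inclusions preserves inclusions in both
directions. -/
structure PreservesInclusions {C : Type*} [Category* C] {D : Type*} [Category* D]
    (P : MorphismProperty C) (Q : MorphismProperty D) (Φ : IsoCat C D) : Prop where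
  map_inclusion : ∀ {a b : C} (i : a ⟶ b), P i → Q (Φ.functor.map i)
  inverse_map_inclusion : ∀ {a b : D} (i : a ⟶ b), Q i → P (Φ.inverse.map i)

/-! ### Inverse semigroups -/

namespace IsInverseSemigroup

variable {S : Type w} [Semigroup S]

/-! Both directions pass through a `Realization` of `C` in an inverse semigroup `S`: objects are the
idempotents, morphisms `a ⟶ b` are the elements of `e a * S * e b`, and the inclusions among them
are those represented by `e a`. The category `𝕃(S)` has one because commuting idempotents make the
idempotent generator of a principal left ideal unique.

In a realization every axiom becomes a statement about elements. Inclusions give the natural order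
of idempotents, meets are products, and a retraction onto `a` is again `e a`. If `x` is the inverse
of `φ`, the normal factorisation of `φ` has coimage `φ * x`, image `x * φ` and middle isomorphism
`φ`. The idempotent inversive cone with apex `c` must be `a ↦ e a * e c`.

Conversely, `S` is rebuilt from `C`. Any two objects are joined by a canonical morphism, and
inversive factorisation says that canonical morphisms `a ⟶ b ⟶ c` compose to the canonical one once
`a ∧ c ≤ b` (`isCanonical_comp`). Morphisms are multiplied by inserting a canonical morphism, and
identified when all their composites with canonical morphisms on both sides agree. Inclusions and
retractions then become classes of identities, so normal factorisation puts an isomorphism in every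
class, which makes the quotient regular. Its idempotents are exactly the classes of identities
(`exists_cls_id_of_idempotent`); they multiply as meets, hence commute, and the quotient is inverse.
It realizes `C`, and `a ↦ S (e a)` is then an isomorphism onto the category of left ideals. -/

theorem mul_comm_of_idempotent (hS : IsInverseSemigroup S) {e f : S} (he : e * e = e)
    (hf : f * f = f) : e * f = f * e := by
  have key : ∀ {e f : S}, e * e = e → f * f = f → (e * f) * (e * f) = e * f := by
    intro e f he hf
    have he' : ∀ y, e * (e * y) = e * y := fun y => by rw [← mul_assoc, he]
    have hf' : ∀ y, f * (f * y) = f * y := fun y => by rw [← mul_assoc, hf]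
    obtain ⟨x, ⟨h₁, h₂⟩, -⟩ := hS (e * f)
    have h₂' : ∀ y, x * (e * (f * (x * y))) = x * y := fun y => by
      conv_rhs => rw [← h₂]
      simp only [mul_assoc]
    simp only [mul_assoc] at h₁ h₂
    -- With `x`, the element `f * x * e` is also an inverse of `e * f`, so the two agree. This makes
    -- `x` idempotent, hence its own inverse, and so equal to `e * f`.
    have hx : f * x * e = x := (hS (e * f)).unique
      ⟨by simp only [mul_assoc, he', hf', h₁], by simp only [mul_assoc, he', hf', h₂']⟩
      ⟨by simp only [mul_assoc, h₁], by simp only [mul_assoc, h₂]⟩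
    have hxx : x * x = x := by
      calc x * x = f * x * e * (f * x * e) := by rw [hx]
        _ = f * (x * (e * (f * (x * e)))) := by simp only [mul_assoc]
        _ = f * x * e := by rw [h₂', mul_assoc]
        _ = x := hx
    have : e * f = x := (hS x).unique
      ⟨by simp only [mul_assoc, h₂], by simp only [mul_assoc, h₁]⟩ ⟨by rw [hxx, hxx], by rw [hxx, hxx]⟩
    rw [this, hxx]
  have he' : ∀ y, e * (e * y) = e * y := fun y => by rw [← mul_assoc, he]
  have hf' : ∀ y, f * (f * y) = f * y := fun y => by rw [← mul_assoc, hf]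
  have h₁ := key he hf
  have h₂ := key hf he
  -- Both `e * f` and `f * e` are inverses of `e * f`.
  refine (hS (e * f)).unique ⟨by rw [h₁, h₁], by rw [h₁, h₁]⟩ ⟨?_, ?_⟩
  · simpa only [mul_assoc, he', hf'] using h₁
  · simpa only [mul_assoc, he', hf'] using h₂

/-- If `b` and `c` are inverses of `a`, commuting `a * b` with `a * c` gives `b = b * a * c`, and
commuting `b * a` with `c * a` gives `b * a * c = c`. -/
theorem of_regular_of_commute (reg : ∀ a : S, ∃ b, a * b * a = a)
    (comm : ∀ e f : S, e * e = e → f * f = f → e * f = f * e) : IsInverseSemigroup S := by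
  intro a
  obtain ⟨b, hb⟩ := reg a
  have hb' : ∀ y, a * (b * (a * y)) = a * y := fun y => by
    conv_rhs => rw [← hb]
    simp only [mul_assoc]
  have hb'' : a * (b * a) = a := by rw [← mul_assoc, hb]
  refine ⟨b * a * b, ⟨by simp only [mul_assoc, hb', hb''], by simp only [mul_assoc, hb']⟩, ?_⟩
  have key : ∀ b c : S, a * b * a = a → b * a * b = b → a * c * a = a → c * a * c = c →
      b = c := by
    intro b c h₁ h₂ h₃ h₄
    have iab : (a * b) * (a * b) = a * b := by rw [← mul_assoc, h₁]
    have iac : (a * c) * (a * c) = a * c := by rw [← mul_assoc, h₃]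
    have iba : (b * a) * (b * a) = b * a := by rw [← mul_assoc, h₂]
    have ica : (c * a) * (c * a) = c * a := by rw [← mul_assoc, h₄]
    calc b = b * (a * b) := by rw [← mul_assoc, h₂]
      _ = b * ((a * c) * (a * b)) := by rw [← mul_assoc (a * c), h₃]
      _ = b * ((a * b) * (a * c)) := by rw [comm _ _ iac iab]
      _ = b * (a * c) := by rw [← mul_assoc (a * b), h₁]
      _ = (b * a) * c := by rw [mul_assoc]
      _ = (b * a) * ((c * a) * c) := by rw [h₄]
      _ = (c * a) * (b * a) * c := by rw [← mul_assoc, comm _ _ iba ica]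
      _ = c * (a * b * a) * c := by simp only [mul_assoc]
      _ = c := by rw [h₁, h₄]
  rintro c ⟨h₁, h₂⟩
  exact key _ _ h₁ h₂ (by simp only [mul_assoc, hb', hb'']) (by simp only [mul_assoc, hb'])

end IsInverseSemigroup

/-! ### Realizations of a category in a semigroup

A realization identifies the objects of `C` with the idempotents of `S` and the morphisms from
`a` to `b` with the local set `e a * S * e b`, the inclusions being the idempotents. -/

/-- A realization of the category `C` with inclusions `P` by the elements of a semigroup `S`. -/
structure Realization {C : Type u} [Category.{v} C] (P : MorphismProperty C) (S : Type w)
    [Semigroup S] where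
  e : C → S
  hom : ∀ {a b : C}, (a ⟶ b) → S
  e_injective : Function.Injective e
  e_mul_self : ∀ a, e a * e a = e a
  exists_e : ∀ x : S, x * x = x → ∃ a, e a = x
  hom_id : ∀ a, hom (𝟙 a) = e a
  hom_comp : ∀ {a b c : C} (f : a ⟶ b) (g : b ⟶ c), hom (f ≫ g) = hom f * hom g
  hom_injective : ∀ {a b : C} {f g : a ⟶ b}, hom f = hom g → f = g
  exists_hom : ∀ (a b : C) (x : S), e a * x = x → x * e b = x → ∃ f : a ⟶ b, hom f = x
  inclusion_iff : ∀ {a b : C} (i : a ⟶ b), P i ↔ hom i = e a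

namespace Realization

variable {C : Type u} [Category.{v} C] {P : MorphismProperty C} {S : Type w} [Semigroup S]
  (R : Realization P S)

theorem e_mul_hom {a b : C} (f : a ⟶ b) : R.e a * R.hom f = R.hom f := by
  rw [← R.hom_id, ← R.hom_comp, Category.id_comp]

theorem hom_mul_e {a b : C} (f : a ⟶ b) : R.hom f * R.e b = R.hom f := by
  rw [← R.hom_id, ← R.hom_comp, Category.comp_id]

/-- Pull a realization back along an isomorphism of categories. -/
def comap {D : Type*} [Category* D] {Q : MorphismProperty D} (F : D ⥤ C) [F.IsIso]
    (hF : ∀ {a b : D} (i : a ⟶ b), Q i ↔ P (F.map i)) : Realization Q S where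
  e a := R.e (F.obj a)
  hom f := R.hom (F.map f)
  e_injective := R.e_injective.comp F.bijective_obj.1
  e_mul_self a := R.e_mul_self _
  exists_e x hx := by
    obtain ⟨a, rfl⟩ := R.exists_e x hx
    obtain ⟨d, rfl⟩ := F.bijective_obj.2 a
    exact ⟨d, rfl⟩
  hom_id a := by rw [F.map_id, R.hom_id]
  hom_comp f g := by rw [F.map_comp, R.hom_comp]
  hom_injective h := F.map_injective (R.hom_injective h)
  exists_hom a b x h₁ h₂ := by
    obtain ⟨f, rfl⟩ := R.exists_hom _ _ x h₁ h₂
    exact ⟨F.preimage f, by rw [F.map_preimage]⟩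
  inclusion_iff i := by rw [hF, R.inclusion_iff]

theorem subobjectLE_iff {a b : C} : SubobjectLE P a b ↔ R.e a * R.e b = R.e a := by
  constructor
  · rintro ⟨i, hi⟩
    rw [R.inclusion_iff] at hi
    rw [← hi, R.hom_mul_e]
  · intro h
    obtain ⟨i, hi⟩ := R.exists_hom a b (R.e a) (R.e_mul_self a) h
    exact ⟨i, (R.inclusion_iff i).2 hi⟩

theorem exists_retraction {a b : C} (h : R.e b * R.e a = R.e a) :
    ∃ q : b ⟶ a, R.hom q = R.e a :=
  R.exists_hom b a _ h (R.e_mul_self a)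

/-! ### The axioms of an inversive category from a realization in an inverse semigroup -/

section Inverse

variable (hS : IsInverseSemigroup S)
include R hS

theorem e_comm (a b : C) : R.e a * R.e b = R.e b * R.e a :=
  hS.mul_comm_of_idempotent (R.e_mul_self a) (R.e_mul_self b)

theorem isCategoryWithSubobjects : IsCategoryWithSubobjects P where
  isMultiplicative :=
    { id_mem := fun a => (R.inclusion_iff _).2 (R.hom_id a)
      comp_mem := fun i j hi hj => by
        rw [R.inclusion_iff] at hi hj ⊢
        rw [R.hom_comp, hj, R.hom_mul_e, hi] }
  thin i j hi hj := R.hom_injective <| by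
    rw [(R.inclusion_iff i).1 hi, (R.inclusion_iff j).1 hj]
  strict {a b} i j hi hj _ _ := by
    have h₁ := R.subobjectLE_iff.1 ⟨i, hi⟩
    have h₂ := R.subobjectLE_iff.1 ⟨j, hj⟩
    have h : a = b := R.e_injective (by rw [← h₁, R.e_comm hS, h₂])
    subst h
    exact ⟨rfl, R.hom_injective (by rw [eqToHom_refl, R.hom_id, (R.inclusion_iff i).1 hi])⟩
  mono {a b} i hi := ⟨fun g h hgh => R.hom_injective <| by
    have := congrArg R.hom hgh
    rwa [R.hom_comp, R.hom_comp, (R.inclusion_iff i).1 hi, R.hom_mul_e, R.hom_mul_e] at this⟩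
  of_comp α ψ hψ h := by
    rw [R.inclusion_iff] at hψ h ⊢
    rwa [R.hom_comp, hψ, R.hom_mul_e] at h

theorem isMeet_singleton (a : C) : IsMeet P a {a} := by
  have := (R.isCategoryWithSubobjects hS).isMultiplicative
  constructor
  · rintro x rfl
    exact ⟨𝟙 _, P.id_mem _⟩
  · exact fun d hd => hd a rfl

theorem isMeet_insert {a d m : C} {s : Set C} (hd : IsMeet P d s)
    (hm : R.e m = R.e d * R.e a) : IsMeet P m (insert a s) := by
  have := (R.isCategoryWithSubobjects hS).isMultiplicative
  have hma : SubobjectLE P m a := by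
    rw [R.subobjectLE_iff, hm, mul_assoc, R.e_mul_self]
  have hmd : SubobjectLE P m d := by
    rw [R.subobjectLE_iff, hm, R.e_comm hS d a, mul_assoc, R.e_mul_self]
  constructor
  · rintro x (rfl | hx)
    · exact hma
    · obtain ⟨i, hi⟩ := hmd
      obtain ⟨j, hj⟩ := hd.1 x hx
      exact ⟨i ≫ j, P.comp_mem _ _ hi hj⟩
  · intro x hx
    have h₁ := R.subobjectLE_iff.1 (hx a (Set.mem_insert _ _))
    have h₂ := R.subobjectLE_iff.1 (hd.2 x fun y hy => hx y (Set.mem_insert_of_mem _ hy))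
    rw [R.subobjectLE_iff, hm, ← mul_assoc, h₂, h₁]

theorem exists_e_eq_mul (a b : C) : ∃ d, R.e d = R.e a * R.e b := by
  refine R.exists_e _ ?_
  rw [mul_assoc, R.e_comm hS a b, ← mul_assoc (R.e b), R.e_mul_self, ← mul_assoc, R.e_comm hS a b,
    mul_assoc, R.e_mul_self]

theorem isMeet_pair {a b d : C} (hd : R.e d = R.e a * R.e b) : IsMeet P d {a, b} :=
  R.isMeet_insert hS (R.isMeet_singleton hS b) (by rw [hd, R.e_comm hS])

theorem isMeet_pair_iff {a b d : C} : IsMeet P d {a, b} ↔ R.e d = R.e a * R.e b := by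
  refine ⟨fun h => ?_, R.isMeet_pair hS⟩
  obtain ⟨m, hm⟩ := R.exists_e_eq_mul hS a b
  have h' := R.isMeet_pair hS hm
  have h₁ := R.subobjectLE_iff.1 (h.2 m h'.1)
  have h₂ := R.subobjectLE_iff.1 (h'.2 d h.1)
  rw [← hm, ← h₂, R.e_comm hS, h₁]

theorem isSOCategory : IsSOCategory P where
  toIsCategoryWithSubobjects := R.isCategoryWithSubobjects hS
  exists_meet a b := by
    obtain ⟨d, hd⟩ := R.exists_e_eq_mul hS a b
    exact ⟨d, R.isMeet_pair hS hd⟩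

/-- The element `x` of `q` satisfies `e a * x = e a` and `x * e a = x`. Hence it is idempotent and
commutes with `e a`, which forces `x = e a`. -/
theorem hom_eq_of_splits {a b : C} {i : a ⟶ b} (hi : P i) {q : b ⟶ a} (hq : Splits i q) :
    R.hom q = R.e a := by
  have h₁ : R.e a * R.hom q = R.e a := by
    rw [← (R.inclusion_iff i).1 hi, ← R.hom_comp, hq, R.hom_id, (R.inclusion_iff i).1 hi]
  have h₂ := R.hom_mul_e q
  have h₃ : R.hom q * R.hom q = R.hom q := by
    calc R.hom q * R.hom q = R.hom q * R.e a * R.hom q := by rw [h₂]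
      _ = R.hom q := by rw [mul_assoc, h₁, h₂]
  rw [← h₁, hS.mul_comm_of_idempotent (R.e_mul_self a) h₃, h₂]

theorem isRetraction_iff {a b : C} (q : b ⟶ a) : IsRetraction P q ↔ R.hom q = R.e a := by
  constructor
  · rintro ⟨i, hi, hq⟩
    exact R.hom_eq_of_splits hS hi hq
  · intro h
    have hba : R.e b * R.e a = R.e a := by rw [← h, R.e_mul_hom]
    obtain ⟨i, hi⟩ := R.subobjectLE_iff.2 ((R.e_comm hS a b).trans hba)
    refine ⟨i, hi, R.hom_injective ?_⟩
    rw [R.hom_comp, (R.inclusion_iff i).1 hi, h, R.hom_id, R.e_mul_self]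

theorem splits_uniquely {a b : C} (i : a ⟶ b) (hi : P i) : ∃! q : b ⟶ a, Splits i q := by
  obtain ⟨q, hq⟩ := R.exists_retraction
    ((R.e_comm hS b a).trans (R.subobjectLE_iff.1 ⟨i, hi⟩))
  refine ⟨q, R.hom_injective ?_, fun q' hq' => R.hom_injective ?_⟩
  · rw [R.hom_comp, (R.inclusion_iff i).1 hi, hq, R.hom_id, R.e_mul_self]
  · rw [hq, R.hom_eq_of_splits hS hi hq']

/-- The elements that occur in a normal factorisation. -/
theorem normalFactorisation_hom {a b : C} {φ : a ⟶ b} (F : NormalFactorisation P φ) :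
    R.hom F.θ = R.e F.coim ∧ R.hom F.σ.hom = R.hom φ ∧ R.hom F.ι = R.e F.im ∧
      R.hom φ * R.hom F.σ.inv = R.e F.coim ∧ R.hom F.σ.inv * R.hom φ = R.e F.im := by
  have hθ := (R.isRetraction_iff hS F.θ).1 F.retraction
  have hι := (R.inclusion_iff F.ι).1 F.inclusion
  have hσ : R.hom F.σ.hom = R.hom φ := by
    conv_rhs => rw [← F.fac, R.hom_comp, R.hom_comp, hθ, hι, R.hom_mul_e, R.e_mul_hom]
  refine ⟨hθ, hσ, hι, ?_, ?_⟩
  · rw [← hσ, ← R.hom_comp, F.σ.hom_inv_id, R.hom_id]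
  · rw [← hσ, ← R.hom_comp, F.σ.inv_hom_id, R.hom_id]

theorem exists_normalFactorisation {a b : C} (φ : a ⟶ b) {x : S}
    (h₁ : R.hom φ * x * R.hom φ = R.hom φ) (h₂ : x * R.hom φ * x = x) :
    ∃ F : NormalFactorisation P φ, R.e F.coim = R.hom φ * x ∧ R.e F.im = x * R.hom φ := by
  obtain ⟨c, hc⟩ := R.exists_e (R.hom φ * x) (by rw [← mul_assoc, h₁])
  obtain ⟨d, hd⟩ := R.exists_e (x * R.hom φ) (by rw [← mul_assoc, h₂])
  obtain ⟨θ, hθ⟩ := R.exists_retraction (a := c) (b := a)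
    (by rw [hc, ← mul_assoc, R.e_mul_hom])
  obtain ⟨ι, hι⟩ := R.exists_hom d b (R.e d) (R.e_mul_self d) (by rw [hd, mul_assoc, R.hom_mul_e])
  obtain ⟨σ, hσ⟩ := R.exists_hom c d (R.hom φ) (by rw [hc, h₁]) (by rw [hd, ← mul_assoc, h₁])
  obtain ⟨τ, hτ⟩ := R.exists_hom d c x (by rw [hd, h₂]) (by rw [hc, ← mul_assoc, h₂])
  refine ⟨⟨c, d, θ, ⟨σ, τ, R.hom_injective ?_, R.hom_injective ?_⟩, ι,
    (R.isRetraction_iff hS θ).2 hθ, (R.inclusion_iff ι).2 hι, R.hom_injective ?_⟩, hc, hd⟩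
  · rw [R.hom_comp, R.hom_id, hσ, hτ, hc]
  · rw [R.hom_comp, R.hom_id, hσ, hτ, hd]
  · rw [R.hom_comp, R.hom_comp, hθ, hι, R.hom_mul_e, R.e_mul_hom, hσ]

/-- The element of `F.σ.inv` is an inverse of that of `φ`, so it does not depend on `F`; it
determines the coimage and the image, and these determine the rest. -/
theorem subsingleton_normalFactorisation {a b : C} (φ : a ⟶ b) (F G : NormalFactorisation P φ) :
    F = G := by
  obtain ⟨hθ, hσ, hι, h₁, h₂⟩ := R.normalFactorisation_hom hS F
  obtain ⟨hθ', hσ', hι', h₁', h₂'⟩ := R.normalFactorisation_hom hS G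
  have inv : ∀ F : NormalFactorisation P φ, R.hom φ * R.hom F.σ.inv * R.hom φ = R.hom φ ∧
      R.hom F.σ.inv * R.hom φ * R.hom F.σ.inv = R.hom F.σ.inv := by
    intro F
    obtain ⟨-, hσ, -, h₁, h₂⟩ := R.normalFactorisation_hom hS F
    exact ⟨by rw [h₁, ← hσ, R.e_mul_hom], by rw [h₂, R.e_mul_hom]⟩
  have h := (hS (R.hom φ)).unique (inv F) (inv G)
  obtain ⟨c, d, θ, σ, ι, rθ, pι, fac⟩ := F
  obtain ⟨c', d', θ', σ', ι', rθ', pι', fac'⟩ := G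
  dsimp only at *
  obtain rfl : c = c' := R.e_injective (by rw [← h₁, ← h₁', h])
  obtain rfl : d = d' := R.e_injective (by rw [← h₂, ← h₂', h])
  obtain rfl : θ = θ' := R.hom_injective (hθ.trans hθ'.symm)
  obtain rfl : ι = ι' := R.hom_injective (hι.trans hι'.symm)
  obtain rfl : σ = σ' := Iso.ext (R.hom_injective (hσ.trans hσ'.symm))
  rfl

theorem unique_normalFactorisation {a b : C} (φ : a ⟶ b) :
    Nonempty (Unique (NormalFactorisation P φ)) := by
  obtain ⟨x, ⟨h₁, h₂⟩, -⟩ := hS (R.hom φ)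
  obtain ⟨F, -⟩ := R.exists_normalFactorisation hS φ h₁ h₂
  exact ⟨⟨⟨F⟩, fun G => R.subsingleton_normalFactorisation hS φ _ _⟩⟩

/-- Each inclusion is absorbed by the factor before it and each retraction onto `d` contributes `e
d`, so the whole product is the product of the idempotents of the odd-numbered objects. -/
theorem exists_meet_of_alternatingProduct {a b : C} {f : a ⟶ b} {s : Set C}
    (h : AlternatingProduct P a b f s) : ∃ d, IsMeet P d s ∧ R.hom f = R.e d := by
  induction h with
  | nil => exact ⟨a, R.isMeet_singleton hS a, R.hom_id a⟩
  | @snoc b c d f s i q hf hi hq ih =>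
    obtain ⟨m, hm, hfm⟩ := ih
    obtain ⟨n, hn⟩ := R.exists_e_eq_mul hS m d
    refine ⟨n, R.isMeet_insert hS hm hn, ?_⟩
    rw [R.hom_comp, R.hom_comp, (R.inclusion_iff i).1 hi, (R.isRetraction_iff hS q).1 hq,
      ← mul_assoc, R.hom_mul_e, hfm, hn]

theorem hasInversiveFactorisation {a b : C} (f : a ⟶ b) : HasInversiveFactorisation P f := by
  intro s hs
  obtain ⟨d, hd, hf⟩ := R.exists_meet_of_alternatingProduct hS hs
  obtain ⟨q, hq⟩ := R.exists_retraction (a := d) (b := a) (by rw [← hf, R.e_mul_hom])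
  obtain ⟨i, hi⟩ := R.exists_hom d b (R.e d) (R.e_mul_self d) (by rw [← hf, R.hom_mul_e])
  refine ⟨d, q, i, hd, (R.isRetraction_iff hS q).2 hq, (R.inclusion_iff i).2 hi,
    R.hom_injective ?_⟩
  rw [R.hom_comp, hq, hi, R.e_mul_self, hf]

/-- An idempotent inversive cone with apex `c` has the components `e a * e c`. -/
theorem hom_app_of_isIdempotent (γ : SubobjectCone P) (hγ : γ.IsInversive)
    (hγ' : γ.IsIdempotent) (a : C) : R.hom (γ.app a) = R.e a * R.e γ.apex := by
  obtain ⟨m, hm, hcoim⟩ := hγ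
  obtain ⟨F, hF⟩ := hγ'
  have hiso : IsIso (γ.app m) := by
    have : m ∈ γ.mSet := by rw [hm]; rfl
    exact this
  -- The coimage of `γ.app a` is `a ∧ m`, so this component is determined by its restriction to `a ∧
  -- m`, which is also the restriction of `γ.app m`.
  have happ : ∀ a, R.hom (γ.app a) = R.e a * R.hom (γ.app m) := by
    intro a
    obtain ⟨G, hG⟩ := hcoim a
    have hGe := (R.isMeet_pair_iff hS).1 hG
    obtain ⟨hθ, hσ, -, h₁, h₂⟩ := R.normalFactorisation_hom hS G
    obtain ⟨i, hi⟩ := hG.1 a (by simp)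
    obtain ⟨j, hj⟩ := hG.1 m (by simp)
    have e₁ := congrArg R.hom (γ.comp_app i hi)
    have e₂ := congrArg R.hom (γ.comp_app j hj)
    rw [R.hom_comp, (R.inclusion_iff i).1 hi] at e₁
    rw [R.hom_comp, (R.inclusion_iff j).1 hj] at e₂
    have e₃ : R.e G.coim * R.hom (γ.app a) = R.hom (γ.app a) := by
      rw [← hσ, R.e_mul_hom]
    rw [← e₃, e₁, ← e₂, hGe, mul_assoc, R.e_mul_hom]
  obtain ⟨hθ, hσ, hι, h₁, h₂⟩ := R.normalFactorisation_hom hS F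
  have hepi : R.hom F.epiComponent = R.hom (γ.app γ.apex) := by
    rw [NormalFactorisation.epiComponent, R.hom_comp, hθ, R.e_mul_hom, hσ]
  have hstar : ∀ a, R.hom (γ.app a) = R.hom (γ.app a) * R.hom (γ.app γ.apex) := by
    intro a
    -- The two sides of `hF` have apexes that are not syntactically equal; generalizing one side to
    -- `δ` allows substitution.
    have : ∀ δ : SubobjectCone P, δ = γ.star F.epiComponent →
        R.hom (δ.app a) = R.hom (γ.app a) * R.hom (γ.app γ.apex) := by
      rintro δ rfl
      rw [← hepi]
      exact R.hom_comp _ _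
    exact this γ hF
  -- Idempotency at `m`, after cancelling the isomorphism `γ.app m`, makes the component at the apex
  -- an identity. The apex thus lies in the `M`-set `{m}`.
  have h_apex : R.hom (γ.app γ.apex) = R.e γ.apex := by
    have h := congrArg (R.hom (inv (γ.app m)) * ·) (hstar m)
    simp only [← R.hom_comp, IsIso.inv_hom_id, IsIso.inv_hom_id_assoc, R.hom_id] at h
    exact h.symm
  have h_mem : γ.apex ∈ γ.mSet := by
    have h : γ.app γ.apex = 𝟙 _ := R.hom_injective (by rw [h_apex, R.hom_id])
    change IsIso (γ.app γ.apex)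
    rw [h]
    infer_instance
  rw [hm] at h_mem
  have h_m : γ.apex = m := h_mem
  rw [happ a, ← h_m, h_apex]

theorem exists_cone (c : C) : ∃ μ : SubobjectCone P,
    (μ.apex = c ∧ μ.IsInversive ∧ μ.IsIdempotent) := by
  have hex : ∀ a, ∃ f : a ⟶ c, R.hom f = R.e a * R.e c := fun a =>
    R.exists_hom a c _ (by rw [← mul_assoc, R.e_mul_self]) (by rw [mul_assoc, R.e_mul_self])
  choose f hf using hex
  let μ : SubobjectCone P := ⟨c, f, fun {a b} i hi => R.hom_injective (by
    rw [R.hom_comp, (R.inclusion_iff i).1 hi, hf, hf, ← mul_assoc, R.subobjectLE_iff.1 ⟨i, hi⟩])⟩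
  have hfc : f c = 𝟙 c := R.hom_injective (by rw [hf, R.hom_id, R.e_mul_self])
  have hidem : ∀ a, R.hom (f a) * R.hom (f a) = R.hom (f a) := by
    intro a
    obtain ⟨d, hd⟩ := R.exists_e_eq_mul hS a c
    rw [hf, ← hd, R.e_mul_self]
  have hfac : ∀ a, ∃ F : NormalFactorisation P (f a), R.e F.coim = R.e a * R.e c ∧
      R.e F.im = R.e a * R.e c := by
    intro a
    obtain ⟨F, h₁, h₂⟩ := R.exists_normalFactorisation hS (f a) (x := R.hom (f a))
      (by rw [hidem, hidem]) (by rw [hidem, hidem])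
    exact ⟨F, by rw [h₁, hidem, hf], by rw [h₂, hidem, hf]⟩
  refine ⟨μ, rfl, ⟨c, ?_, fun a => ?_⟩, ?_⟩
  · ext a
    constructor
    · intro (h : IsIso (f a))
      have h₁ := congrArg R.hom (IsIso.hom_inv_id (f a))
      have h₂ := congrArg R.hom (IsIso.inv_hom_id (f a))
      rw [R.hom_comp, R.hom_id] at h₁ h₂
      -- An idempotent element representing an isomorphism equals the identities at both ends, so `a
      -- = c`.
      have h₃ : R.e a = R.hom (f a) := by
        calc R.e a = R.hom (f a) * R.e a := by rw [← h₁, ← mul_assoc, hidem]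
          _ = R.hom (f a) := by rw [hf, R.e_comm hS a c, mul_assoc, R.e_mul_self]
      have h₄ : R.e c = R.hom (f a) := by
        calc R.e c = R.e c * R.hom (f a) := by rw [← h₂, mul_assoc, hidem]
          _ = R.hom (f a) := by rw [hf, R.e_comm hS a c, ← mul_assoc, R.e_mul_self]
      exact R.e_injective (h₃.trans h₄.symm)
    · rintro rfl
      change IsIso (f _)
      rw [hfc]
      infer_instance
  · obtain ⟨F, h, -⟩ := hfac a
    exact ⟨F, (R.isMeet_pair_iff hS).2 h⟩
  · obtain ⟨F, -, h⟩ := hfac c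
    have him : F.im = c := R.e_injective (by rw [h, R.e_mul_self])
    obtain ⟨hθ, hσ, -⟩ := R.normalFactorisation_hom hS F
    have hepi : R.hom F.epiComponent = R.e c := by
      rw [NormalFactorisation.epiComponent, R.hom_comp, hθ, R.e_mul_hom, hσ, hf, R.e_mul_self]
    refine ⟨F, ?_⟩
    have key : ∀ {d : C} (φ : c ⟶ d), d = c → R.hom φ = R.e c → μ = μ.star φ := by
      rintro d φ rfl hφ
      have : φ = 𝟙 _ := R.hom_injective (by rw [hφ, R.hom_id])
      subst this
      have happ : f = fun a => f a ≫ 𝟙 d := by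
        funext a
        rw [Category.comp_id]
      simp only [SubobjectCone.star, μ, SubobjectCone.mk.injEq, heq_eq_eq, true_and]
      exact happ
    exact key F.epiComponent him hepi

theorem unique_cone (c : C) : ∃! μ : SubobjectCone P,
    μ.apex = c ∧ μ.IsInversive ∧ μ.IsIdempotent := by
  obtain ⟨μ, hμ⟩ := R.exists_cone hS c
  refine ⟨μ, hμ, fun ν hν => ?_⟩
  have h₁ := R.hom_app_of_isIdempotent hS μ hμ.2.1 hμ.2.2
  have h₂ := R.hom_app_of_isIdempotent hS ν hν.2.1 hν.2.2
  have hμc := hμ.1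
  have hνc := hν.1
  clear hμ hν
  obtain ⟨m, f, hf⟩ := μ
  obtain ⟨n, g, hg⟩ := ν
  dsimp only at *
  subst hμc
  subst hνc
  obtain rfl : f = g := funext fun a => R.hom_injective ((h₁ a).trans (h₂ a).symm)
  rfl

theorem isInversiveCategory : IsInversiveCategory P where
  isSOCategory := R.isSOCategory hS
  splits_uniquely i hi := R.splits_uniquely hS i hi
  unique_normalFactorisation φ := R.unique_normalFactorisation hS φ
  inversive_factorisation f _ := R.hasInversiveFactorisation hS f
  unique_cone c := R.unique_cone hS c

end Inverse

end Realization

/-! ### The category of left ideals -/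

namespace PrincipalLeftIdeal

variable {S : Type w} [Semigroup S]

theorem mem_leftIdeal_self {e : S} (he : e * e = e) : e ∈ leftIdeal e := ⟨e, he.symm⟩

theorem mem_leftIdeal_iff {e : S} (he : e * e = e) {x : S} : x ∈ leftIdeal e ↔ x * e = x := by
  constructor
  · rintro ⟨s, rfl⟩
    rw [mul_assoc, he]
  · exact fun h => ⟨x, h.symm⟩

theorem ext_carrier {I J : PrincipalLeftIdeal S} (h : I.carrier = J.carrier) : I = J := by
  cases I
  cases J
  cases h
  rfl

/-- A generating idempotent of a principal left ideal. -/
noncomputable def gen (I : PrincipalLeftIdeal S) : S := I.exists_idempotent.choose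

theorem gen_mul_gen (I : PrincipalLeftIdeal S) : I.gen * I.gen = I.gen :=
  I.exists_idempotent.choose_spec.1

theorem carrier_eq (I : PrincipalLeftIdeal S) : I.carrier = leftIdeal I.gen :=
  I.exists_idempotent.choose_spec.2

theorem mem_carrier_iff (I : PrincipalLeftIdeal S) {x : S} : x ∈ I.carrier ↔ x * I.gen = x := by
  rw [carrier_eq, mem_leftIdeal_iff I.gen_mul_gen]

theorem gen_mem (I : PrincipalLeftIdeal S) : I.gen ∈ I.carrier :=
  I.mem_carrier_iff.2 I.gen_mul_gen

/-- The image of the generating idempotent. -/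
noncomputable def Hom.elem {I J : PrincipalLeftIdeal S} (φ : I ⟶ J) : S :=
  (Hom.toFun φ ⟨I.gen, I.gen_mem⟩ : J.carrier)

theorem toFun_eq {I J : PrincipalLeftIdeal S} (φ : I ⟶ J) (x : I.carrier) :
    ((Hom.toFun φ x : J.carrier) : S) = x * Hom.elem φ := by
  obtain ⟨e, u, f, h⟩ := Hom.exists_translation φ
  rw [Hom.elem, h.apply_eq, h.apply_eq, ← mul_assoc, I.mem_carrier_iff.1 x.2]

theorem hom_ext {I J : PrincipalLeftIdeal S} {φ ψ : I ⟶ J}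
    (h : ∀ x : I.carrier, ((Hom.toFun φ x : J.carrier) : S) = (Hom.toFun ψ x : J.carrier)) :
    φ = ψ :=
  Hom.ext (funext fun x => Subtype.ext (h x))

/-- Right multiplication by `u`, as a morphism of left ideals. -/
def translation {I J : PrincipalLeftIdeal S} (e u f : S) (he : e * e = e) (hf : f * f = f)
    (hI : I.carrier = leftIdeal e) (hJ : J.carrier = leftIdeal f) (heu : e * u = u)
    (huf : u * f = u) : I ⟶ J :=
  ({ toFun := fun x => ⟨x * u, by rw [hJ, mem_leftIdeal_iff hf, mul_assoc, huf]⟩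
     exists_translation := ⟨e, u, f, he, hf, hI, hJ, ⟨u, by rw [heu, huf]⟩, fun _ => rfl⟩ } :
    Hom I J)

/-- The category of left ideals of an inverse semigroup is realized by the semigroup. -/
noncomputable def realization (hS : IsInverseSemigroup S) : Realization (inclusions S) S where
  e := gen
  hom := Hom.elem
  e_injective I J h := ext_carrier (by rw [carrier_eq, carrier_eq, h])
  e_mul_self := gen_mul_gen
  exists_e x hx := by
    refine ⟨⟨leftIdeal x, x, hx, rfl⟩, ?_⟩
    set I : PrincipalLeftIdeal S := ⟨leftIdeal x, x, hx, rfl⟩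
    -- The chosen generator need not be `x` by definition, but idempotents generating the same left
    -- ideal absorb each other, and commuting makes them equal.
    have h₁ : I.gen * x = I.gen := (mem_leftIdeal_iff hx).1 I.gen_mem
    have h₂ : x * I.gen = x := I.mem_carrier_iff.1 (mem_leftIdeal_self hx)
    rw [← h₁, hS.mul_comm_of_idempotent I.gen_mul_gen hx, h₂]
  hom_id I := rfl
  hom_comp {I J K} φ ψ := by
    change ((Hom.toFun ψ (Hom.toFun φ _) : K.carrier) : S) = _
    rw [toFun_eq]
    rfl
  hom_injective h := hom_ext fun x => by rw [toFun_eq, toFun_eq, h]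
  exists_hom I J x h₁ h₂ := ⟨translation I.gen x J.gen I.gen_mul_gen J.gen_mul_gen I.carrier_eq
    J.carrier_eq h₁ h₂, h₁⟩
  inclusion_iff {I J} φ := by
    constructor
    · exact fun h => h _
    · intro h x
      rw [toFun_eq, h, I.mem_carrier_iff.1 x.2]

end PrincipalLeftIdeal

/-! ### The isomorphism onto the category of left ideals -/

namespace Realization

variable {C : Type u} [Category.{v} C] {P : MorphismProperty C} {S : Type w} [Semigroup S]
  (R : Realization P S)

/-- The functor sending an object `a` to the left ideal generated by `e a`. -/
def toLeftIdeals : C ⥤ PrincipalLeftIdeal S where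
  obj a := ⟨leftIdeal (R.e a), R.e a, R.e_mul_self a, rfl⟩
  map {a b} f := PrincipalLeftIdeal.translation (R.e a) (R.hom f) (R.e b) (R.e_mul_self a)
    (R.e_mul_self b) rfl rfl (R.e_mul_hom f) (R.hom_mul_e f)
  map_id a := PrincipalLeftIdeal.hom_ext fun x => by
    change (x : S) * R.hom (𝟙 a) = x
    rw [R.hom_id]
    exact (PrincipalLeftIdeal.mem_leftIdeal_iff (R.e_mul_self a)).1 x.2
  map_comp f g := PrincipalLeftIdeal.hom_ext fun x => by
    change (x : S) * R.hom (f ≫ g) = x * R.hom f * R.hom g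
    rw [R.hom_comp, mul_assoc]

theorem toLeftIdeals_map_apply {a b : C} (f : a ⟶ b) (x : (R.toLeftIdeals.obj a).carrier) :
    ((PrincipalLeftIdeal.Hom.toFun (R.toLeftIdeals.map f) x : (R.toLeftIdeals.obj b).carrier) : S)
      = x * R.hom f :=
  rfl

theorem e_mem (a : C) : R.e a ∈ (R.toLeftIdeals.obj a).carrier :=
  PrincipalLeftIdeal.mem_leftIdeal_self (R.e_mul_self a)

theorem inclusions_toLeftIdeals_iff {a b : C} (i : a ⟶ b) :
    PrincipalLeftIdeal.inclusions S (R.toLeftIdeals.map i) ↔ P i := by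
  rw [R.inclusion_iff]
  constructor
  · intro h
    have := h ⟨R.e a, R.e_mem a⟩
    rwa [toLeftIdeals_map_apply, R.e_mul_hom] at this
  · intro h x
    rw [toLeftIdeals_map_apply, h]
    exact (PrincipalLeftIdeal.mem_leftIdeal_iff (R.e_mul_self a)).1 x.2

theorem isIso_toLeftIdeals (hS : IsInverseSemigroup S) : R.toLeftIdeals.IsIso where
  faithful := ⟨fun {a b f g} h => R.hom_injective <| by
    have := congrArg (fun φ => ((PrincipalLeftIdeal.Hom.toFun φ ⟨R.e a, R.e_mem a⟩ :
      (R.toLeftIdeals.obj b).carrier) : S)) h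
    simpa only [toLeftIdeals_map_apply, R.e_mul_hom] using this⟩
  full := ⟨fun {a b} φ => by
    obtain ⟨e, u, f, h⟩ := PrincipalLeftIdeal.Hom.exists_translation φ
    -- The idempotents `e`, `f` of the translation need not be those of the realization, so `u` is
    -- replaced by the image of `R.e a`.
    obtain ⟨g, hg⟩ := R.exists_hom a b (R.e a * u) (by rw [← mul_assoc, R.e_mul_self]) (by
      have := (PrincipalLeftIdeal.Hom.toFun φ ⟨R.e a, R.e_mem a⟩ :
        (R.toLeftIdeals.obj b).carrier).2
      rw [h.apply_eq] at this
      exact (PrincipalLeftIdeal.mem_leftIdeal_iff (R.e_mul_self b)).1 this)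
    refine ⟨g, PrincipalLeftIdeal.hom_ext fun x => ?_⟩
    rw [toLeftIdeals_map_apply, h.apply_eq, hg, ← mul_assoc,
      (PrincipalLeftIdeal.mem_leftIdeal_iff (R.e_mul_self a)).1 x.2]⟩
  bijective_obj := by
    constructor
    · intro a b h
      have h : leftIdeal (R.e a) = leftIdeal (R.e b) :=
        congrArg PrincipalLeftIdeal.carrier h
      have h₁ := R.e_mem a
      have h₂ := R.e_mem b
      change R.e a ∈ leftIdeal (R.e a) at h₁
      change R.e b ∈ leftIdeal (R.e b) at h₂
      rw [h, PrincipalLeftIdeal.mem_leftIdeal_iff (R.e_mul_self b)] at h₁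
      rw [← h, PrincipalLeftIdeal.mem_leftIdeal_iff (R.e_mul_self a)] at h₂
      exact R.e_injective (by rw [← h₁, R.e_comm hS, h₂])
    · rintro ⟨I, x, hx, rfl⟩
      obtain ⟨a, rfl⟩ := R.exists_e x hx
      exact ⟨a, rfl⟩

end Realization

theorem MorphismProperty.map_iff_of_eq_id {C : Type u} [Category.{v} C] (P : MorphismProperty C)
    {G : C ⥤ C} (hG : G = 𝟭 C) {a b : C} (f : a ⟶ b) : P (G.map f) ↔ P f := by
  subst hG
  rfl

/-! ### Canonical morphisms of an inversive category -/

theorem IsCategoryWithSubobjects.antisymm {C : Type u} [Category.{v} C] {P : MorphismProperty C}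
    (h : IsCategoryWithSubobjects P) {a b : C} (hab : SubobjectLE P a b)
    (hba : SubobjectLE P b a) : a = b := by
  have := h.isMultiplicative
  obtain ⟨i, hi⟩ := hab
  obtain ⟨j, hj⟩ := hba
  exact (h.strict i j hi hj (h.thin _ _ (P.comp_mem _ _ hi hj) (P.id_mem _))
    (h.thin _ _ (P.comp_mem _ _ hj hi) (P.id_mem _))).1

theorem IsCategoryWithSubobjects.trans {C : Type u} [Category.{v} C] {P : MorphismProperty C}
    (h : IsCategoryWithSubobjects P) {a b c : C} (hab : SubobjectLE P a b)
    (hbc : SubobjectLE P b c) : SubobjectLE P a c := by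
  have := h.isMultiplicative
  obtain ⟨i, hi⟩ := hab
  obtain ⟨j, hj⟩ := hbc
  exact ⟨i ≫ j, P.comp_mem _ _ hi hj⟩

/-- A canonical morphism `a ⟶ b`: the retraction onto the meet of `a` and `b`, followed by the
inclusion. -/
def IsCanonical {C : Type u} [Category.{v} C] (P : MorphismProperty C) {a b : C} (f : a ⟶ b) :
    Prop :=
  ∃ (d : C) (q : a ⟶ d) (i : d ⟶ b), IsMeet P d {a, b} ∧ IsRetraction P q ∧ P i ∧ f = q ≫ i

namespace IsInversiveCategory

variable {C : Type u} [Category.{v} C] {P : MorphismProperty C} (h : IsInversiveCategory P)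
include h

theorem isMultiplicative : P.IsMultiplicative := h.isSOCategory.isMultiplicative

theorem isRetraction_unique {a b : C} {q q' : a ⟶ b} (hq : IsRetraction P q)
    (hq' : IsRetraction P q') : q = q' := by
  obtain ⟨i, hi, hiq⟩ := hq
  obtain ⟨j, hj, hjq⟩ := hq'
  obtain rfl := h.isSOCategory.thin i j hi hj
  exact (h.splits_uniquely i hi).unique hiq hjq

theorem isRetraction_id (a : C) : IsRetraction P (𝟙 a) := by
  have := h.isMultiplicative
  exact ⟨𝟙 a, P.id_mem a, Category.id_comp _⟩

theorem isCanonical_unique {a b : C} {f g : a ⟶ b} (hf : IsCanonical P f)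
    (hg : IsCanonical P g) : f = g := by
  obtain ⟨d, q, i, hd, hq, hi, rfl⟩ := hf
  obtain ⟨d', q', i', hd', hq', hi', rfl⟩ := hg
  obtain rfl : d = d' := h.isSOCategory.antisymm (hd'.2 d hd.1) (hd.2 d' hd'.1)
  rw [h.isRetraction_unique hq hq', h.isSOCategory.thin i i' hi hi']

theorem exists_isCanonical (a b : C) : ∃ f : a ⟶ b, IsCanonical P f := by
  obtain ⟨d, hd⟩ := h.isSOCategory.exists_meet a b
  obtain ⟨j, hj⟩ := hd.1 a (by simp)
  obtain ⟨i, hi⟩ := hd.1 b (by simp)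
  obtain ⟨q, hq, -⟩ := h.splits_uniquely j hj
  exact ⟨q ≫ i, d, q, i, hd, ⟨j, hj, hq⟩, hi, rfl⟩

theorem isCanonical_of_inclusion {a b : C} {i : a ⟶ b} (hi : P i) : IsCanonical P i := by
  have := h.isMultiplicative
  refine ⟨a, 𝟙 a, i, ⟨?_, fun x hx => hx a (by simp)⟩, h.isRetraction_id a, hi, by simp⟩
  rintro x (rfl | rfl)
  · exact ⟨𝟙 _, P.id_mem _⟩
  · exact ⟨i, hi⟩

theorem isCanonical_of_isRetraction {a b : C} {q : a ⟶ b} (hq : IsRetraction P q) :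
    IsCanonical P q := by
  have := h.isMultiplicative
  refine ⟨b, q, 𝟙 b, ⟨?_, fun x hx => hx b (by simp)⟩, hq, P.id_mem b, by simp⟩
  obtain ⟨i, hi, -⟩ := hq
  rintro x (rfl | rfl)
  · exact ⟨i, hi⟩
  · exact ⟨𝟙 _, P.id_mem _⟩

/-- The composite runs through `a`, `a ∧ b`, `b ∧ c`, `c` as odd-numbered objects of an alternating
product. By inversive factorisation it goes through their meet `a ∧ b ∧ c`, which is `a ∧ c` by
`hb`. -/
theorem isCanonical_comp {a b c : C} {f : a ⟶ b} {g : b ⟶ c} (hf : IsCanonical P f)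
    (hg : IsCanonical P g) (hb : ∀ x, SubobjectLE P x a → SubobjectLE P x c → SubobjectLE P x b) :
    IsCanonical P (f ≫ g) := by
  have hP := h.isMultiplicative
  have hso := h.isSOCategory.toIsCategoryWithSubobjects
  obtain ⟨d, q, i, hd, hq, hi, rfl⟩ := hf
  obtain ⟨d', q', i', hd', hq', hi', rfl⟩ := hg
  -- An alternating product starts with an inclusion and ends with a retraction; the identities at
  -- both ends supply them.
  have alt : AlternatingProduct P a c (((𝟙 a ≫ 𝟙 a ≫ q) ≫ i ≫ q') ≫ i' ≫ 𝟙 c)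
      {c, d', d, a} :=
    .snoc _ _ _ _ (.snoc _ _ _ _ (.snoc _ _ _ _ .nil (P.id_mem a) hq) hi hq') hi'
      (h.isRetraction_id c)
  have hcore : core P (((𝟙 a ≫ 𝟙 a ≫ q) ≫ i ≫ q') ≫ i' ≫ 𝟙 c) := by
    have hr : ∀ {x y : C} (f : x ⟶ y), IsRetraction P f → core P f := fun f hf =>
      .of f (Or.inr hf)
    have hp : ∀ {x y : C} (f : x ⟶ y), P f → core P f := fun f hf => .of f (Or.inl hf)
    have : (core P).IsMultiplicative := by unfold core; infer_instance
    simp only [Category.id_comp, Category.comp_id]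
    exact (core P).comp_mem _ _ ((core P).comp_mem _ _ (hr _ hq)
      ((core P).comp_mem _ _ (hp _ hi) (hr _ hq'))) (hp _ hi')
  obtain ⟨m, r, j, hm, hr, hj, hfac⟩ := h.inversive_factorisation _ hcore _ alt
  refine ⟨m, r, j, ⟨?_, fun x hx => hm.2 x ?_⟩, hr, hj, ?_⟩
  · rintro x (rfl | rfl)
    · exact hm.1 _ (by simp)
    · exact hm.1 _ (by simp)
  · have hxa := hx a (by simp)
    have hxc := hx c (by simp)
    have hxb := hb x hxa hxc
    rintro y (rfl | rfl | rfl | rfl)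
    · exact hxc
    · exact hd'.2 x (by rintro z (rfl | rfl) <;> assumption)
    · exact hd.2 x (by rintro z (rfl | rfl) <;> assumption)
    · exact hxa
  · rw [← hfac]
    simp

end IsInversiveCategory

/-- A choice of the canonical morphisms, with their composition law. -/
structure CanonicalSystem {C : Type u} [Category.{v} C] (P : MorphismProperty C) where
  map : ∀ a b : C, a ⟶ b
  isCanonical_map : ∀ a b : C, IsCanonical P (map a b)
  eq_map : ∀ {a b : C} {f : a ⟶ b}, IsCanonical P f → f = map a b
  map_comp_map : ∀ {a b c : C},
    (∀ x, SubobjectLE P x a → SubobjectLE P x c → SubobjectLE P x b) →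
      map a b ≫ map b c = map a c

/-- The canonical morphisms of an inversive category. -/
noncomputable def IsInversiveCategory.canonicalSystem {C : Type u} [Category.{v} C]
    {P : MorphismProperty C} (h : IsInversiveCategory P) : CanonicalSystem P where
  map a b := (h.exists_isCanonical a b).choose
  isCanonical_map a b := (h.exists_isCanonical a b).choose_spec
  eq_map hf := h.isCanonical_unique hf (h.exists_isCanonical _ _).choose_spec
  map_comp_map hb := h.isCanonical_unique (h.isCanonical_comp
    (h.exists_isCanonical _ _).choose_spec (h.exists_isCanonical _ _).choose_spec hb)
    (h.exists_isCanonical _ _).choose_spec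

/-! ### The semigroup of an inversive category

The morphisms of `C` form a semigroup under `f * g = f ≫ κ ≫ g`, with `κ` the canonical morphism
from the codomain of `f` to the domain of `g`; the inverse semigroup is a quotient of it. -/

namespace CanonicalSystem

variable {C : Type u} [Category.{v} C] {P : MorphismProperty C} (K : CanonicalSystem P)

/-- The morphisms of `C`, as a type that carries the multiplication given by `K`. -/
@[nolint unusedArguments]
structure Mor (K : CanonicalSystem P) where
  dom : C
  cod : C
  hom : dom ⟶ cod

instance : Semigroup K.Mor where
  mul f g := ⟨f.dom, g.cod, f.hom ≫ K.map f.cod g.dom ≫ g.hom⟩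
  mul_assoc f g k := by
    change Mor.mk _ _ ((_ ≫ _ ≫ _) ≫ _ ≫ _) = Mor.mk _ _ (_ ≫ _ ≫ _ ≫ _ ≫ _)
    simp only [Category.assoc]
    rfl

variable {K} in
/-- The morphism `x ⟶ y` obtained from `f` by composing with canonical morphisms. -/
def Mor.transfer (f : K.Mor) (x y : C) : x ⟶ y := K.map x f.dom ≫ f.hom ≫ K.map f.cod y

/-- A product depends on its left factor only through transfers of that factor. With the mirror
statement, this makes equality of transfers a congruence. -/
theorem transfer_mul_left (f g : K.Mor) (x y : C) :
    (f * g).transfer x y = f.transfer x g.dom ≫ g.hom ≫ K.map g.cod y := by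
  change K.map x f.dom ≫ (f.hom ≫ K.map f.cod g.dom ≫ g.hom) ≫ K.map g.cod y = _
  simp only [Mor.transfer, Category.assoc]

theorem transfer_mul_right (f g : K.Mor) (x y : C) :
    (f * g).transfer x y = K.map x f.dom ≫ f.hom ≫ g.transfer f.cod y := by
  change K.map x f.dom ≫ (f.hom ≫ K.map f.cod g.dom ≫ g.hom) ≫ K.map g.cod y = _
  simp only [Mor.transfer, Category.assoc]

/-- Two morphisms are identified if all their transfers agree. -/
def con : Con K.Mor where
  r f g := ∀ x y, f.transfer x y = g.transfer x y
  iseqv := ⟨fun _ _ _ => rfl, fun h x y => (h x y).symm, fun h h' x y => (h x y).trans (h' x y)⟩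
  mul' {f f' g g'} h h' x y := by
    rw [transfer_mul_left, h, ← transfer_mul_left, transfer_mul_right, h', ← transfer_mul_right]

/-- The class of a morphism. -/
def cls {a b : C} (f : a ⟶ b) : K.con.Quotient := ((⟨a, b, f⟩ : K.Mor) : K.con.Quotient)

theorem cls_eq_iff {a b a' b' : C} {f : a ⟶ b} {f' : a' ⟶ b'} :
    K.cls f = K.cls f' ↔
      ∀ x y, K.map x a ≫ f ≫ K.map b y = K.map x a' ≫ f' ≫ K.map b' y :=
  K.con.eq

theorem exists_cls (s : K.con.Quotient) : ∃ (a b : C) (f : a ⟶ b), K.cls f = s := by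
  induction s using Con.induction_on with
  | H f => exact ⟨f.dom, f.cod, f.hom, rfl⟩

theorem cls_mul_cls {a b c d : C} (f : a ⟶ b) (g : c ⟶ d) :
    K.cls f * K.cls g = K.cls (f ≫ K.map b c ≫ g) :=
  rfl

/-! ### Idempotents and inverses in the quotient semigroup -/

section

variable (h : IsInversiveCategory P)
include h

theorem inclusion_eq_map {a b : C} {i : a ⟶ b} (hi : P i) : i = K.map a b :=
  K.eq_map (h.isCanonical_of_inclusion hi)

theorem retraction_eq_map {a b : C} {q : a ⟶ b} (hq : IsRetraction P q) : q = K.map a b :=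
  K.eq_map (h.isCanonical_of_isRetraction hq)

theorem map_self (a : C) : K.map a a = 𝟙 a := by
  have := h.isMultiplicative
  exact (K.inclusion_eq_map h (P.id_mem a)).symm

theorem cls_mul_cls_comp {a b c : C} (f : a ⟶ b) (g : b ⟶ c) :
    K.cls f * K.cls g = K.cls (f ≫ g) := by
  rw [cls_mul_cls, K.map_self h, Category.id_comp]

theorem cls_injective {a b : C} {f g : a ⟶ b} (hfg : K.cls f = K.cls g) : f = g := by
  have := K.cls_eq_iff.1 hfg a b
  simpa only [K.map_self h, Category.id_comp, Category.comp_id] using this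

theorem cls_inclusion {a b : C} {i : a ⟶ b} (hi : P i) : K.cls i = K.cls (𝟙 a) := by
  rw [cls_eq_iff]
  intro x y
  rw [K.inclusion_eq_map h hi, K.map_comp_map, Category.id_comp]
  exact fun z hz _ => h.isSOCategory.trans hz ⟨i, hi⟩

theorem cls_retraction {a b : C} {q : a ⟶ b} (hq : IsRetraction P q) :
    K.cls q = K.cls (𝟙 b) := by
  rw [cls_eq_iff]
  intro x y
  rw [K.retraction_eq_map h hq, ← Category.assoc, K.map_comp_map, Category.id_comp]
  obtain ⟨i, hi, -⟩ := hq
  exact fun z _ hz => h.isSOCategory.trans hz ⟨i, hi⟩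

theorem cls_id_mul_self (a : C) : K.cls (𝟙 a) * K.cls (𝟙 a) = K.cls (𝟙 a) := by
  rw [K.cls_mul_cls_comp h, Category.id_comp]

theorem cls_id_mul_cls_id {a b d : C} (hd : IsMeet P d {a, b}) :
    K.cls (𝟙 a) * K.cls (𝟙 b) = K.cls (𝟙 d) := by
  rw [cls_mul_cls, Category.comp_id, Category.id_comp]
  obtain ⟨m, q, i, hm, hq, hi, hfac⟩ := K.isCanonical_map a b
  obtain rfl : m = d := h.isSOCategory.antisymm (hd.2 m hm.1) (hm.2 d hd.1)
  rw [hfac, ← K.cls_mul_cls_comp h, K.cls_retraction h hq, K.cls_inclusion h hi,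
    K.cls_id_mul_self h]

/-- In a normal factorisation the retraction and the inclusion have classes of identities, so only
the isomorphism survives. -/
theorem exists_iso_cls (s : K.con.Quotient) : ∃ (a b : C) (σ : a ≅ b), K.cls σ.hom = s := by
  obtain ⟨a, b, f, rfl⟩ := K.exists_cls s
  obtain ⟨⟨⟨F⟩, -⟩⟩ := h.unique_normalFactorisation f
  refine ⟨F.coim, F.im, F.σ, ?_⟩
  conv_rhs => rw [← F.fac, ← K.cls_mul_cls_comp h, ← K.cls_mul_cls_comp h,
    K.cls_retraction h F.retraction, K.cls_inclusion h F.inclusion, K.cls_mul_cls_comp h,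
    K.cls_mul_cls_comp h, Category.comp_id, Category.id_comp]

theorem subobjectLE_of_cls_id_eq {c d : C} (hcd : K.cls (𝟙 c) = K.cls (𝟙 d)) :
    SubobjectLE P c d := by
  obtain ⟨m, q, i, hm, hq, hi, hfac⟩ := K.isCanonical_map c d
  obtain ⟨j, hj⟩ := hm.1 c (by simp)
  have hP := h.isMultiplicative
  -- Transfer from `c` to `c` gives `𝟙 c = q ≫ j`, with `q` the retraction onto `c ∧ d` and `j` its
  -- inclusion into `c`. Hence `q` is an inclusion and `c ≤ c ∧ d`.
  have h₁ := K.cls_eq_iff.1 hcd c c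
  rw [K.map_self h, Category.id_comp, Category.id_comp, Category.id_comp, hfac, Category.assoc,
    K.inclusion_eq_map h hi, K.map_comp_map
      (fun z hz _ => h.isSOCategory.trans hz ⟨i, hi⟩), ← K.inclusion_eq_map h hj] at h₁
  have hqP : P q := h.isSOCategory.of_comp q j hj (by rw [← h₁]; exact P.id_mem c)
  exact h.isSOCategory.trans ⟨q, hqP⟩ ⟨i, hi⟩

theorem cls_id_injective {c d : C} (hcd : K.cls (𝟙 c) = K.cls (𝟙 d)) : c = d :=
  h.isSOCategory.antisymm (K.subobjectLE_of_cls_id_eq h hcd)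
    (K.subobjectLE_of_cls_id_eq h hcd.symm)

theorem exists_cls_id_of_idempotent (s : K.con.Quotient) (hs : s * s = s) :
    ∃ a : C, K.cls (𝟙 a) = s := by
  have hP := h.isMultiplicative
  obtain ⟨a, b, σ, rfl⟩ := K.exists_iso_cls h s
  -- Idempotency makes the canonical morphism `q ≫ i : b ⟶ a` the inverse of `σ`. Left cancellation
  -- of inclusions then yields `a ≤ b` and `b ≤ a`, so this morphism is an identity, and so is `σ`.
  have h₁ : σ.hom ≫ K.map b a ≫ σ.hom = σ.hom := K.cls_injective h (by rw [← cls_mul_cls, hs])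
  have h₂ : σ.hom ≫ K.map b a = 𝟙 a := by
    rw [← cancel_mono σ.hom, Category.assoc, h₁, Category.id_comp]
  have h₃ : K.map b a ≫ σ.hom = 𝟙 b := by
    rw [← cancel_epi σ.hom, h₁, Category.comp_id]
  obtain ⟨m, q, i, hm, ⟨j, hj, hjq⟩, hi, hfac⟩ := K.isCanonical_map b a
  rw [hfac] at h₂ h₃
  have hab : SubobjectLE P a b := by
    refine h.isSOCategory.trans ⟨σ.hom ≫ q, h.isSOCategory.of_comp _ i hi ?_⟩ ⟨j, hj⟩
    rw [Category.assoc, h₂]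
    exact P.id_mem a
  have hba : SubobjectLE P b a := by
    refine h.isSOCategory.trans ⟨q, h.isSOCategory.of_comp q j hj ?_⟩ ⟨i, hi⟩
    -- The retraction `q` has the right inverse `i ≫ σ.hom`, so `j`, which satisfies `j ≫ q = 𝟙 m`,
    -- is a two-sided inverse of `q`.
    have : q ≫ j = 𝟙 b := by
      calc q ≫ j = q ≫ j ≫ (q ≫ i) ≫ σ.hom := by rw [h₃, Category.comp_id]
        _ = q ≫ (j ≫ q) ≫ i ≫ σ.hom := by simp only [Category.assoc]
        _ = (q ≫ i) ≫ σ.hom := by rw [hjq, Category.id_comp, Category.assoc]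
        _ = 𝟙 b := h₃
    rw [this]
    exact P.id_mem b
  obtain rfl := h.isSOCategory.antisymm hab hba
  refine ⟨a, ?_⟩
  rw [← hfac, K.map_self h, Category.comp_id] at h₂
  rw [h₂]

theorem isInverseSemigroup : IsInverseSemigroup K.con.Quotient := by
  refine IsInverseSemigroup.of_regular_of_commute (fun s => ?_) fun s t hs ht => ?_
  · obtain ⟨a, b, σ, rfl⟩ := K.exists_iso_cls h s
    exact ⟨K.cls σ.inv, by rw [K.cls_mul_cls_comp h, K.cls_mul_cls_comp h, σ.hom_inv_id,
      Category.id_comp]⟩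
  · obtain ⟨a, rfl⟩ := K.exists_cls_id_of_idempotent h s hs
    obtain ⟨b, rfl⟩ := K.exists_cls_id_of_idempotent h t ht
    obtain ⟨d, hd⟩ := h.isSOCategory.exists_meet a b
    rw [K.cls_id_mul_cls_id h hd, K.cls_id_mul_cls_id h (by rwa [Set.pair_comm])]

/-- An inversive category is realized by its semigroup. -/
def realization : Realization P K.con.Quotient where
  e a := K.cls (𝟙 a)
  hom f := K.cls f
  e_injective _ _ := K.cls_id_injective h
  e_mul_self := K.cls_id_mul_self h
  exists_e := K.exists_cls_id_of_idempotent h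
  hom_id _ := rfl
  hom_comp f g := (K.cls_mul_cls_comp h f g).symm
  hom_injective := K.cls_injective h
  exists_hom a b s h₁ h₂ := by
    obtain ⟨c, d, f, rfl⟩ := K.exists_cls s
    refine ⟨(𝟙 a ≫ K.map a c ≫ f) ≫ K.map d b ≫ 𝟙 b, ?_⟩
    rw [← cls_mul_cls, ← cls_mul_cls, h₁, h₂]
  inclusion_iff {a b} i := by
    refine ⟨K.cls_inclusion h, fun hi => ?_⟩
    obtain ⟨d, hd⟩ := h.isSOCategory.exists_meet a b
    -- This forces `a ∧ b = a`, so an inclusion `a ⟶ b` exists; it has the same class as `i`, hence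
    -- equals `i`.
    have hmul : K.cls (𝟙 a) * K.cls (𝟙 b) = K.cls (𝟙 a) := by
      rw [← hi, K.cls_mul_cls_comp h, Category.comp_id]
    rw [K.cls_id_mul_cls_id h hd] at hmul
    obtain rfl := K.cls_id_injective h hmul
    obtain ⟨j, hj⟩ := hd.1 b (by simp)
    rwa [K.cls_injective h (hi.trans (K.cls_inclusion h hj).symm)]

end

end CanonicalSystem

/-! ### The equivalence -/

theorem mainTheorem8 (C : Type u) [Category.{v} C] (P : MorphismProperty C) :
    IsInversiveCategory P ↔
      ∃ (S : Type (max u v)) (_ : Semigroup S), IsInverseSemigroup S ∧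
        ∃ Φ : IsoCat C (PrincipalLeftIdeal S),
          PreservesInclusions P (PrincipalLeftIdeal.inclusions S) Φ := by
  constructor
  · intro h
    let K := h.canonicalSystem
    let R := K.realization h
    have hS := K.isInverseSemigroup h
    have := R.isIso_toLeftIdeals hS
    refine ⟨K.con.Quotient, inferInstance, hS, R.toLeftIdeals.asIsomorphism,
      fun i hi => (R.inclusions_toLeftIdeals_iff i).2 hi, fun {a b} i hi => ?_⟩
    refine (R.inclusions_toLeftIdeals_iff _).1 ?_
    exact (MorphismProperty.map_iff_of_eq_id (PrincipalLeftIdeal.inclusions K.con.Quotient)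
      R.toLeftIdeals.asIsomorphism.counit_eq i).2 hi
  · rintro ⟨S, _, hS, Φ, hΦ⟩
    refine ((PrincipalLeftIdeal.realization hS).comap (Q := P) Φ.functor
      fun {a b} i => ⟨hΦ.map_inclusion i, fun hi => ?_⟩).isInversiveCategory hS
    exact (MorphismProperty.map_iff_of_eq_id P Φ.unit_eq.symm i).1
      (hΦ.inverse_map_inclusion _ hi)
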